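/- Let $F$ be a field and let $n\ge 1$ be an integer. Write $\mathbb M_n(F)$ for the ring of $n\times n$ matrices over $F$; a matrix $E\in\mathbb M_n(F)$ is idempotent if $E^2=E$, and $\mathbb Z_m$ denotes the ring of integers modulo $m$. The following three conditions are equivalent: 1. every matrix in $\mathbb M_n(F)$ is a sum of three idempotent matrices of $\mathbb M_n(F)$; 2. every invertible matrix in $\mathbb M_n(F)$ is a sum of three idempotent matrices of $\mathbb M_n(F)$; 3. $F\cong\mathbb Z_2$ or $F\cong\mathbb Z_3$ as rings. -/

import Mathlib

/-- An element `a` of a ring is a sum of three idempotents (repetitions and zero are allowed). -/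
def IsSumOfThreeIdempotents {R : Type*} [Ring R] (a : R) : Prop :=
  ∃ e f g : R, IsIdempotentElem e ∧ IsIdempotentElem f ∧ IsIdempotentElem g ∧ a = e + f + g

/-!
**Over `𝔽₂` and `𝔽₃` every matrix works.** Viewing the space as an `F[X]`-module splits it into cyclic
modules `F[X] ⧸ (q)`, and sums of three idempotents are compatible with direct sums and with change
of basis. On a cyclic module of dimension `m + 1` the basis `u j = p j • 1`, for monic polynomials
`p j` of degree `j` chosen suitably, makes `T = X • ·` satisfy `T (u j) = u j + u (j + 1)` for
`j < m`, up to an extra `x • u 0` in `T (u 0)`. The bidiagonal part is the sum of two idempotents,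
one acting on the pairs `(u 0, u 1), (u 2, u 3), …` and the other on the pairs
`(u 1, u 2), (u 3, u 4), …`. The difference has a single nonzero column, the last one, so it is
idempotent exactly when its trace is `1`. The unpaired ends of the chain leave two free diagonal
entries `x, y ∈ {0, 1}`, and `x + y` takes every value of `F`, so the trace can always be adjusted
(`isSumOfThreeIdempotents_of_hessenberg`).

**Over any other field some invertible matrix fails.** The trace of an idempotent is a natural number
in `F`, so testing `diag (a, 1, …, 1)` shows that `F` has no elements but the images of integers.
It remains to exclude the fields in which `2` and `3` are nonzero. For idempotents `f` and `g`, the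
elements `c = f + g - 1` and `d = f - g` satisfy `d c = - c d` and `c² + d² = 1`. Hence for
`ν² ≠ 1` the map `d` carries the `ν`-eigenspace of `c` injectively into the `-ν`-eigenspace. If
`3/2 + R = e + f + g`, then `c = 1/2 - e + R`, which on `ker R` is `1/2` on `ker e` and `-1/2` on
`range e`. For `R = 0` this forces each idempotent to have rank half the dimension, so `3/2` fails
in odd dimension. In even dimension, if `R` has rank one, it forces the ranks to be half the
dimension up to one; deviating by one makes `c² = 1/4`, so that `c` has trace zero and `tr R = ±1`,
while equality for all three gives `tr R = 0` (`trace_of_scalar_add_rank_one`). The choice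
`R = diag (-2, 0, …, 0)` violates this, and `3/2 + R` is invertible.
-/

open Module Polynomial

/-! ### Chains of vectors and sums of three idempotents -/

theorem IsSumOfThreeIdempotents.map {R S G : Type*} [Ring R] [Ring S] [FunLike G R S]
    [RingHomClass G R S] {a : R} (h : IsSumOfThreeIdempotents a) (φ : G) :
    IsSumOfThreeIdempotents (φ a) := by
  obtain ⟨e, f, g, he, hf, hg, rfl⟩ := h
  exact ⟨φ e, φ f, φ g, he.map φ, hf.map φ, hg.map φ, by simp⟩

section Hessenberg

variable {F V : Type*} [Field F] [AddCommGroup V] [Module F V]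

/-- The endomorphism sending `u j` to `u j + u (j + 1)` and `u (j + 1)` to `0` for every `j < m` of
parity `s`. The vectors left unpaired are multiplied by scalars: `u 0` by `x` if `s ≠ 0`, and `u m`
by `y` if `m` has parity `s`. The basis `b` is read through a sequence `u` with `b j = u j`, so that
successors need no bounds. -/
noncomputable def pairIdempotent {m : ℕ} (b : Basis (Fin (m + 1)) F V) (u : ℕ → V) (x y : F)
    (s : ℕ) : End F V :=
  b.constr F fun j ↦
    if (j : ℕ) % 2 = s then (if (j : ℕ) = m then y • u j else u j + u (j + 1))
    else if (j : ℕ) = 0 then x • u j else 0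

variable {m : ℕ} {b : Basis (Fin (m + 1)) F V} {u : ℕ → V}

theorem pairIdempotent_apply (hu : ∀ j : Fin (m + 1), b j = u j) (x y : F) (s : ℕ) {j : ℕ}
    (hj : j ≤ m) :
    pairIdempotent b u x y s (u j) =
      if j % 2 = s then (if j = m then y • u j else u j + u (j + 1))
      else if j = 0 then x • u j else 0 := by
  have := hu ⟨j, by omega⟩
  simp only at this
  rw [← this, pairIdempotent, Basis.constr_basis, this]

theorem isIdempotentElem_pairIdempotent (hu : ∀ j : Fin (m + 1), b j = u j) {x y : F}
    (hx : x * x = x) (hy : y * y = y) (s : ℕ) :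
    IsIdempotentElem (pairIdempotent b u x y s) := by
  refine b.ext fun j ↦ ?_
  obtain ⟨j, hj⟩ := j
  rw [hu, End.mul_apply]
  simp only
  rw [pairIdempotent_apply hu x y s (by omega : j ≤ m)]
  split_ifs with h1 h2 h3
  · subst h2
    rw [map_smul, pairIdempotent_apply hu x y s le_rfl, if_pos h1, if_pos rfl, smul_smul, hy]
  · rw [map_add, pairIdempotent_apply hu x y s (by omega : j ≤ m),
      pairIdempotent_apply hu x y s (by omega : j + 1 ≤ m), if_pos h1, if_neg h2,
      if_neg (by omega), if_neg (by omega), add_zero]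
  · subst h3
    rw [map_smul, pairIdempotent_apply hu x y s (by omega), if_neg h1, if_pos rfl, smul_smul, hx]
  · exact map_zero _

/-- An endomorphism that is lower bidiagonal with diagonal `(1 + x, 1, …, 1, *)` except in its last
column is a sum of three idempotents if the last column can be corrected by an idempotent of
trace `1`. -/
theorem isSumOfThreeIdempotents_of_hessenberg (hu : ∀ j : Fin (m + 1), b j = u j) {x y : F}
    (hx : x * x = x) (hy : y * y = y) {T : End F V}
    (hT : ∀ j < m, T (u j) = u (j + 1) + (1 + if j = 0 then x else 0) • u j)
    (htr : LinearMap.trace F V T = m + 1 + x + y) : IsSumOfThreeIdempotents T := by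
  set e := pairIdempotent b u x y 0 with he
  set f := pairIdempotent b u x y 1 with hf
  have hsum : ∀ j < m, (e + f) (u j) = T (u j) := by
    intro j hj
    rw [LinearMap.add_apply, he, hf, pairIdempotent_apply hu _ _ _ hj.le,
      pairIdempotent_apply hu _ _ _ hj.le, hT j hj, if_neg hj.ne]
    rcases Nat.mod_two_eq_zero_or_one j with h | h
    · rw [if_pos h, if_neg (by omega)]
      split_ifs <;> module
    · rw [if_pos h, if_neg (by omega), if_neg (by omega),
        if_neg (by omega)]
      module
  have hlast : (e + f) (u m) = (y + if m = 0 then x else 0) • u m := by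
    rw [LinearMap.add_apply, he, hf, pairIdempotent_apply hu _ _ _ le_rfl,
      pairIdempotent_apply hu _ _ _ le_rfl, if_pos rfl]
    rcases Nat.mod_two_eq_zero_or_one m with h | h
    · rw [if_pos h, if_neg (by omega)]
      split_ifs <;> module
    · rw [if_pos h, if_neg (by omega), if_neg (by omega),
        if_neg (by omega)]
      module
  have hbm : b (Fin.last m) = u m := hu _
  have htr' : LinearMap.trace F V (e + f) = m + x + y := by
    rw [LinearMap.trace_eq_matrix_trace F b, Matrix.trace, Fin.sum_univ_castSucc]
    have h1 : ∀ j : Fin m, LinearMap.toMatrix b b (e + f) j.castSucc j.castSucc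
        = 1 + if (j : ℕ) = 0 then x else 0 := by
      intro j
      have h2 : u (j + 1) = b j.succ := by rw [hu]; simp
      have h3 : u j = b j.castSucc := by rw [hu]; simp
      rw [LinearMap.toMatrix_apply, hu, Fin.val_castSucc, hsum j j.2, hT j j.2, h2, h3]
      have : j.succ ≠ j.castSucc := (Fin.castSucc_lt_succ).ne'
      simp [this]
    have h4 : LinearMap.toMatrix b b (e + f) (Fin.last m) (Fin.last m)
        = y + if m = 0 then x else 0 := by
      rw [LinearMap.toMatrix_apply, hbm, hlast, ← hbm]
      simp
    simp only [Matrix.diag_apply, h1, h4]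
    rcases m with _ | m
    · simp [add_comm]
    · simp [Finset.sum_add_distrib, add_assoc, add_comm x y]
  set g := T - (e + f) with hg
  -- Only the last basis vector survives, so `g` has rank at most one and its trace decides.
  have hgw : g = (b.coord (Fin.last m)).smulRight (g (u m)) := by
    refine b.ext fun j ↦ ?_
    induction j using Fin.lastCases with
    | last => rw [LinearMap.smulRight_apply, b.coord_apply, b.repr_self, hbm]; simp
    | cast j =>
      have : j.castSucc ≠ Fin.last m := (Fin.castSucc_lt_last j).ne
      rw [hu, Fin.val_castSucc, hg, LinearMap.sub_apply, hsum j j.2, sub_self]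
      rw [show u j = b j.castSucc by rw [hu]; simp]
      simp [this]
  have : Module.Finite F V := .of_basis b
  have hcoord : b.coord (Fin.last m) (g (u m)) = 1 := by
    have : LinearMap.trace F V g = 1 := by rw [hg, map_sub, htr, htr']; ring
    rwa [hgw, LinearMap.trace_smulRight] at this
  refine ⟨e, f, g, isIdempotentElem_pairIdempotent hu hx hy 0,
    isIdempotentElem_pairIdempotent hu hx hy 1, ?_, by rw [hg]; abel⟩
  rw [IsIdempotentElem, hgw]
  ext v
  simp [hcoord]

end Hessenberg

/-! ### Cyclic modules over the polynomial ring -/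

section Cyclic

variable {F : Type*} [Field F]

/-- The polynomials `1` and `(X - (1 + x)) * (X - 1) ^ j`. Their classes in `F[X] ⧸ (q)` are the basis
in which multiplication by `X` is bidiagonal up to its last column. -/
noncomputable def hessenbergPoly (x : F) : ℕ → F[X]
  | 0 => 1
  | j + 1 => hessenbergPoly x j * (X - C (1 + if j = 0 then x else 0))

theorem monic_hessenbergPoly (x : F) (j : ℕ) : (hessenbergPoly x j).Monic := by
  induction j with
  | zero => exact monic_one
  | succ j ih => exact ih.mul (monic_X_sub_C _)

theorem natDegree_hessenbergPoly (x : F) (j : ℕ) : (hessenbergPoly x j).natDegree = j := by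
  induction j with
  | zero => exact natDegree_one
  | succ j ih =>
    rw [hessenbergPoly, (monic_hessenbergPoly x j).natDegree_mul (monic_X_sub_C _), ih,
      natDegree_X_sub_C]

/-- The polynomials `hessenbergPoly x`, as a sequence with one member in each degree. -/
noncomputable def hessenbergSequence (x : F) : Polynomial.Sequence F where
  elems' := hessenbergPoly x
  degree_eq' j := by
    rw [degree_eq_natDegree (monic_hessenbergPoly x j).ne_zero, natDegree_hessenbergPoly]

theorem linearIndependent_mk_hessenbergPoly (x : F) (q : F[X]) :
    LinearIndependent F fun j : Fin q.natDegree ↦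
      Submodule.Quotient.mk (p := Submodule.span F[X] {q}) (hessenbergPoly x j) := by
  rw [Fintype.linearIndependent_iff]
  intro c hc
  have hsum : ∑ j, c j • hessenbergPoly x (j : ℕ) ∈ Submodule.span F[X] {q} := by
    rw [← Submodule.Quotient.mk_eq_zero, ← hc]
    exact map_sum ((Submodule.mkQ (Submodule.span F[X] {q})).restrictScalars F) _ _
  have hzero : ∑ j, c j • hessenbergPoly x (j : ℕ) = 0 := by
    rcases isEmpty_or_nonempty (Fin q.natDegree) with h | h
    · simp
    refine eq_zero_of_dvd_of_degree_lt (Ideal.mem_span_singleton.1 hsum) ?_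
    have hq : q ≠ 0 := by
      rintro rfl
      rw [natDegree_zero] at h
      exact isEmptyElim h.some
    rw [degree_eq_natDegree hq]
    refine (degree_sum_le _ _).trans_lt ?_
    rw [Finset.sup_lt_iff (WithBot.bot_lt_coe _)]
    intro j _
    refine (degree_smul_le _ _).trans_lt ?_
    rw [degree_eq_natDegree (monic_hessenbergPoly x j).ne_zero, natDegree_hessenbergPoly]
    exact_mod_cast j.2
  have hli := (hessenbergSequence x).linearIndependent.comp
    (fun j : Fin q.natDegree ↦ (j : ℕ)) Fin.val_injective
  exact Fintype.linearIndependent_iff.1 hli c hzero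

/-! ### Fields with no elements but `0`, `1` and `2` -/

variable (hF : ∀ a : F, a = 0 ∨ a = 1 ∨ a = 2)
include hF

theorem exists_idempotent_add (a : F) : ∃ x y : F, x * x = x ∧ y * y = y ∧ a = x + y := by
  rcases hF a with rfl | rfl | rfl
  · exact ⟨0, 0, by simp, by simp, by simp⟩
  · exact ⟨1, 0, by simp, by simp, by simp⟩
  · exact ⟨1, 1, by simp, by simp, by norm_num⟩

theorem isSumOfThreeIdempotents_lsmul_X_quotient {q : F[X]} (hq : q ≠ 0) :
    IsSumOfThreeIdempotents
      (Algebra.lsmul F F (F[X] ⧸ Submodule.span F[X] {q}) (X : F[X])) := by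
  set W := F[X] ⧸ Submodule.span F[X] {q}
  set T : End F W := Algebra.lsmul F F W (X : F[X])
  have hrank : finrank F W = q.natDegree := finrank_quotient_span_eq_natDegree
  have hfin : Module.Finite F W := (AdjoinRoot.powerBasis hq).finite
  rcases hm : q.natDegree with _ | m
  · have : Subsingleton W := finrank_zero_iff.1 (hrank.trans hm)
    exact ⟨0, 0, 0, .zero, .zero, .zero, LinearMap.ext fun _ ↦ Subsingleton.elim _ _⟩
  obtain ⟨x, y, hx, hy, hxy⟩ := exists_idempotent_add hF (LinearMap.trace F W T - (m + 1))
  let b := basisOfLinearIndependentOfCardEqFinrank'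
    (fun j : Fin (m + 1) ↦
      Submodule.Quotient.mk (p := Submodule.span F[X] {q}) (hessenbergPoly x j))
    (hm ▸ linearIndependent_mk_hessenbergPoly x q)
    ((Fintype.card_fin _).trans (hrank.trans hm).symm)
  refine isSumOfThreeIdempotents_of_hessenberg (b := b)
    (u := fun j ↦ Submodule.Quotient.mk (p := Submodule.span F[X] {q}) (hessenbergPoly x j))
    (fun j ↦ congr_fun (coe_basisOfLinearIndependentOfCardEqFinrank' _ _ _) j)
    hx hy (fun j _ ↦ ?_) (by linear_combination hxy)
  change Submodule.Quotient.mk (X • hessenbergPoly x j) =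
    Submodule.Quotient.mk (hessenbergPoly x (j + 1) + _ • hessenbergPoly x j)
  rw [hessenbergPoly, smul_eq_C_mul, smul_eq_mul]
  congr 1
  ring

omit hF in
theorem isSumOfThreeIdempotents_lsmul_directSum {ι : Type*} [DecidableEq ι] {M : ι → Type*}
    [∀ i, AddCommGroup (M i)] [∀ i, Module F (M i)] [∀ i, Module F[X] (M i)]
    [∀ i, IsScalarTower F F[X] (M i)] {r : F[X]}
    (h : ∀ i, IsSumOfThreeIdempotents (Algebra.lsmul F F (M i) r)) :
    IsSumOfThreeIdempotents (Algebra.lsmul F F (DirectSum ι M) r) := by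
  choose e f g he hf hg hsum using h
  have key : ∀ e : ∀ i, End F (M i), (∀ i, IsIdempotentElem (e i)) →
      IsIdempotentElem (DirectSum.lmap e) := by
    intro e he
    ext i x j
    simpa using congr_arg (fun t ↦ DirectSum.lof F ι M i t j) (LinearMap.congr_fun (he i) x)
  refine ⟨_, _, _, key e he, key f hf, key g hg, ?_⟩
  refine LinearMap.ext fun v ↦ DFinsupp.ext fun j ↦ ?_
  exact LinearMap.congr_fun (hsum j) (v j)

theorem isSumOfThreeIdempotents_end {V : Type*} [AddCommGroup V] [Module F V]
    [FiniteDimensional F V] (T : End F V) : IsSumOfThreeIdempotents T := by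
  classical
  obtain ⟨ι, _, p, hp, k, ⟨φ⟩⟩ := Module.equiv_directSum_of_isTorsion
    (Module.AEval.isTorsion_of_finiteDimensional F V T)
  have h := isSumOfThreeIdempotents_lsmul_directSum (r := X) fun i ↦
    isSumOfThreeIdempotents_lsmul_X_quotient hF (pow_ne_zero (k i) (hp i).ne_zero)
  let ψ := (Module.AEval.of F V T).trans (φ.restrictScalars F)
  have hT : T = ψ.symm.conjRingEquiv (Algebra.lsmul F F _ (X : F[X])) := by
    ext v
    apply ψ.injective
    simp [ψ]
  rw [hT]
  exact h.map _

theorem isSumOfThreeIdempotents_matrix {n : Type*} [Fintype n] [DecidableEq n]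
    (A : Matrix n n F) : IsSumOfThreeIdempotents A := by
  have h := (isSumOfThreeIdempotents_end hF (Matrix.toLinAlgEquiv' A)).map
    (Matrix.toLinAlgEquiv' (R := F) (n := n)).symm
  rwa [AlgEquiv.symm_apply_apply] at h

end Cyclic

theorem LinearMap.trace_of_isIdempotentElem {F V : Type*} [Field F] [AddCommGroup V] [Module F V]
    [FiniteDimensional F V] {e : End F V} (he : IsIdempotentElem e) :
    LinearMap.trace F V e = finrank F (LinearMap.range e) :=
  (LinearMap.IsIdempotentElem.isProj_range e he).trace

/-! ### The sum and difference of two idempotents -/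

section Anticommuting

variable {F V : Type*} [Field F] [AddCommGroup V] [Module F V]

theorem anticomm_of_idempotents {R : Type*} [Ring R] {e f : R} (he : IsIdempotentElem e)
    (hf : IsIdempotentElem f) : (e - f) * (e + f - 1) = -((e + f - 1) * (e - f)) := by
  have h1 : e * e = e := he
  have h2 : f * f = f := hf
  simp only [mul_sub, sub_mul, mul_add, add_mul, h1, h2, mul_one, one_mul]
  abel

theorem sq_add_sq_of_idempotents {R : Type*} [Ring R] {e f : R} (he : IsIdempotentElem e)
    (hf : IsIdempotentElem f) :
    (e - f) * (e - f) + (e + f - 1) * (e + f - 1) = 1 := by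
  have h1 : e * e = e := he
  have h2 : f * f = f := hf
  simp only [mul_sub, sub_mul, mul_add, add_mul, h1, h2, mul_one, one_mul]
  abel

variable {c d : End F V}

/-- The map `d` sends one eigenspace into the other, and is injective there because
`d² = 1 - ν² ≠ 0`. -/
theorem finrank_eigenspace_le_neg [FiniteDimensional F V] (hdc : d * c = -(c * d))
    (hsq : d * d + c * c = 1) {ν : F} (hν : ν * ν ≠ 1) :
    finrank F (c.eigenspace ν) ≤ finrank F (c.eigenspace (-ν)) := by
  have hmaps : ∀ v ∈ c.eigenspace ν, d v ∈ c.eigenspace (-ν) := by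
    intro v hv
    rw [End.mem_eigenspace_iff] at hv ⊢
    have := LinearMap.congr_fun hdc v
    simp only [End.mul_apply, LinearMap.neg_apply, hv, map_smul] at this
    rw [neg_smul, this, neg_neg]
  refine LinearMap.finrank_le_finrank_of_injective (f := d.restrict hmaps) ?_
  rw [← LinearMap.ker_eq_bot, LinearMap.ker_eq_bot']
  rintro ⟨v, hv⟩ h
  have hdv : d v = 0 := congr_arg Subtype.val h
  rw [End.mem_eigenspace_iff] at hv
  have := LinearMap.congr_fun hsq v
  simp only [End.mul_apply, LinearMap.add_apply, hdv, map_zero, hv, map_smul, smul_smul,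
    End.one_apply, zero_add] at this
  have h0 : (ν * ν - 1) • v = 0 := by rw [sub_smul, this, one_smul, sub_self]
  exact Subtype.ext ((smul_eq_zero.1 h0).resolve_left (sub_ne_zero.2 hν))

theorem two_mul_finrank_eigenspace_le [FiniteDimensional F V] (hdc : d * c = -(c * d))
    (hsq : d * d + c * c = 1) {ν : F} (hν : ν * ν ≠ 1) (hν' : ν ≠ -ν) :
    2 * finrank F (c.eigenspace ν) ≤ finrank F V ∧
    (2 * finrank F (c.eigenspace ν) = finrank F V → c * c = (ν * ν) • (1 : End F V)) := by
  have h1 := finrank_eigenspace_le_neg hdc hsq hν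
  have h2 := finrank_eigenspace_le_neg hdc hsq (ν := -ν) (by simpa using hν)
  rw [neg_neg] at h2
  have hdisj := c.eigenspaces_iSupIndep.pairwiseDisjoint hν'
  have h3 := Submodule.finrank_sup_add_finrank_inf_eq (c.eigenspace ν) (c.eigenspace (-ν))
  rw [hdisj.eq_bot, finrank_bot] at h3
  refine ⟨by have := Submodule.finrank_le (c.eigenspace ν ⊔ c.eigenspace (-ν)); omega, fun h ↦ ?_⟩
  have htop : c.eigenspace ν ⊔ c.eigenspace (-ν) = ⊤ := Submodule.eq_top_of_finrank_eq (by omega)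
  ext v
  obtain ⟨a, ha, b, hb, rfl⟩ := Submodule.mem_sup.1 (htop ▸ Submodule.mem_top : v ∈ _)
  rw [End.mem_eigenspace_iff] at ha hb
  simp [ha, hb, smul_smul]

theorem trace_eq_zero_of_anticomm (h2 : (2 : F) ≠ 0) (hdc : d * c = -(c * d))
    (hsq : d * d + c * c = 1) {μ : F} (hμ : μ ≠ 1) (hc : c * c = μ • (1 : End F V)) :
    LinearMap.trace F V c = 0 := by
  have hd : d * d = (1 - μ) • (1 : End F V) := by
    rw [sub_smul, one_smul, ← hc, ← hsq, add_sub_cancel_right]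
  have h := LinearMap.trace_mul_comm F d (c * d)
  rw [← mul_assoc, hdc, neg_mul, mul_assoc, hd, mul_smul_comm, mul_one, map_neg, map_smul,
    smul_eq_mul] at h
  have : 2 * ((1 - μ) * LinearMap.trace F V c) = 0 := by linear_combination -h
  simpa [h2, sub_ne_zero.2 hμ.symm] using this

end Anticommuting

/-! ### Perturbations of the scalar `3/2` -/

section Scalar

variable {F V : Type*} [Field F] [AddCommGroup V] [Module F V] [FiniteDimensional F V]

theorem finrank_le_finrank_inf_ker_add (R : End F V) (W : Submodule F V) :
    finrank F W ≤ finrank F (W ⊓ LinearMap.ker R : Submodule F V)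
      + finrank F (LinearMap.range R) := by
  have h1 := Submodule.finrank_sup_add_finrank_inf_eq W (LinearMap.ker R)
  have h2 := LinearMap.finrank_range_add_finrank_ker R
  have h3 := Submodule.finrank_le (W ⊔ LinearMap.ker R)
  omega

/-- Here `k` is the dimension of the `1/2`-eigenspace of `f + g - 1`. It bounds the dimensions of
`ker e` and `range e` up to the rank of `R`. In the extremal case `2 * k = finrank F V` the trace of
`f + g - 1` vanishes, which is the last equation. -/
theorem exists_eigenspace_bound (h2 : (2 : F) ≠ 0) (h3 : (3 : F) ≠ 0) {e f g R : End F V}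
    (he : IsIdempotentElem e) (hf : IsIdempotentElem f) (hg : IsIdempotentElem g)
    (hsum : (3 / 2 : F) • 1 + R = e + f + g) :
    ∃ k : ℕ, 2 * k ≤ finrank F V ∧
      finrank F (LinearMap.range e) ≤ k + finrank F (LinearMap.range R) ∧
      finrank F V ≤ finrank F (LinearMap.range e) + k + finrank F (LinearMap.range R) ∧
      (2 * k = finrank F V →
        (finrank F V : F) / 2 + LinearMap.trace F V R = finrank F (LinearMap.range e)) := by
  set c := f + g - 1 with hc
  have hdc := anticomm_of_idempotents hf hg
  have hsq := sq_add_sq_of_idempotents hf hg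
  rw [← hc] at hdc hsq
  have hcR : c = (1 / 2 : F) • 1 + R - e := by
    have : f + g = (3 / 2 : F) • 1 + R - e := by rw [hsum]; abel
    rw [hc, this]
    have : (3 / 2 : F) • (1 : End F V) = (1 / 2 : F) • 1 + 1 := by
      nth_rw 3 [← one_smul F (1 : End F V)]
      rw [← add_smul]
      congr 1
      field_simp
      norm_num
    rw [this]; abel
  -- This is where `3 ≠ 0` enters: `(1/2)² = 1` means `3 = 0`.
  have hν : (1 / 2 : F) * (1 / 2) ≠ 1 := by
    intro h
    field_simp at h
    apply h3
    linear_combination -h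
  have hν' : (1 / 2 : F) ≠ -(1 / 2) := by
    intro h
    have h1 : (1 / 2 : F) + 1 / 2 = 1 := by field_simp; norm_num
    exact one_ne_zero (by linear_combination -h1 + h : (1 : F) = 0)
  have hle := finrank_eigenspace_le_neg hdc hsq (ν := -(1 / 2)) (by simpa using hν)
  rw [neg_neg] at hle
  obtain ⟨hk, hk'⟩ := two_mul_finrank_eigenspace_le hdc hsq hν hν'
  have hee : ∀ v, e (e v) = e v := fun v ↦ LinearMap.congr_fun he v
  refine ⟨_, hk, ?_, ?_, fun h ↦ ?_⟩
  · refine (finrank_le_finrank_inf_ker_add R _).trans (Nat.add_le_add_right (le_trans ?_ hle) _)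
    refine Submodule.finrank_mono ?_
    rintro v ⟨⟨w, rfl⟩, hv⟩
    rw [SetLike.mem_coe, LinearMap.mem_ker] at hv
    rw [End.mem_eigenspace_iff, hcR]
    simp only [LinearMap.sub_apply, LinearMap.add_apply, LinearMap.smul_apply, End.one_apply,
      hv, hee]
    rw [add_zero, ← sub_eq_zero, neg_smul, sub_neg_eq_add]
    have : (1 / 2 : F) + 1 / 2 = 1 := by field_simp; norm_num
    rw [sub_add_eq_add_sub, ← add_smul, this, one_smul, sub_self]
  · have h4 := LinearMap.finrank_range_add_finrank_ker e
    have h5 := finrank_le_finrank_inf_ker_add R (LinearMap.ker e)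
    have : finrank F (LinearMap.ker e ⊓ LinearMap.ker R : Submodule F V)
        ≤ finrank F (c.eigenspace (1 / 2)) := by
      refine Submodule.finrank_mono ?_
      rintro v ⟨hv, hv'⟩
      rw [SetLike.mem_coe, LinearMap.mem_ker] at hv hv'
      rw [End.mem_eigenspace_iff, hcR]
      simp [hv, hv']
    omega
  · have htr := trace_eq_zero_of_anticomm h2 hdc hsq hν (hk' h)
    rw [hcR, map_sub, map_add, map_smul, LinearMap.trace_one,
      LinearMap.trace_of_isIdempotentElem he, smul_eq_mul] at htr
    linear_combination htr

theorem even_finrank_of_scalar (h2 : (2 : F) ≠ 0) (h3 : (3 : F) ≠ 0)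
    (h : IsSumOfThreeIdempotents ((3 / 2 : F) • (1 : End F V))) : Even (finrank F V) := by
  obtain ⟨e, f, g, he, hf, hg, hsum⟩ := h
  obtain ⟨k, h1, h4, h5, -⟩ :=
    exists_eigenspace_bound (R := 0) h2 h3 he hf hg (by rw [add_zero, hsum])
  rw [LinearMap.range_zero, finrank_bot] at h4 h5
  exact ⟨k, by omega⟩

theorem trace_of_scalar_add_rank_one (h2 : (2 : F) ≠ 0) (h3 : (3 : F) ≠ 0) {R : End F V}
    (hR : finrank F (LinearMap.range R) ≤ 1) (heven : Even (finrank F V))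
    (h : IsSumOfThreeIdempotents ((3 / 2 : F) • (1 : End F V) + R)) :
    LinearMap.trace F V R = 0 ∨ LinearMap.trace F V R = 1 ∨ LinearMap.trace F V R = -1 := by
  obtain ⟨m, hm⟩ := heven
  obtain ⟨e, f, g, he, hf, hg, hsum⟩ := h
  have hV : (finrank F V : F) = 2 * m := by rw [hm]; push_cast; ring
  have key : ∀ {e f g : End F V}, IsIdempotentElem e → IsIdempotentElem f → IsIdempotentElem g →
      (3 / 2 : F) • 1 + R = e + f + g →
      (LinearMap.trace F V R = 1 ∨ LinearMap.trace F V R = -1) ∨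
        LinearMap.trace F V e = m := by
    intro e f g he hf hg hsum
    obtain ⟨k, h1, h4, h5, h6⟩ := exists_eigenspace_bound h2 h3 he hf hg hsum
    rw [LinearMap.trace_of_isIdempotentElem he]
    have hhalf : (finrank F V : F) / 2 = m := by rw [hV]; field_simp
    rw [hhalf] at h6
    by_cases hr : finrank F (LinearMap.range e) = m
    · exact .inr (by rw [hr])
    · have hcases : finrank F (LinearMap.range e) = m + 1 ∨
          finrank F (LinearMap.range e) + 1 = m := by omega
      have h7 := h6 (by omega)
      rcases hcases with h8 | h8
      · rw [h8] at h7
        push_cast at h7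
        exact .inl (.inl (by linear_combination h7))
      · have h9 : (finrank F (LinearMap.range e) : F) + 1 = m := by
          rw [← h8]; push_cast; rfl
        exact .inl (.inr (by linear_combination h7 + h9))
  rcases key he hf hg hsum with h | h4
  · exact .inr h
  rcases key hf hg he (by rw [hsum]; abel) with h | h5
  · exact .inr h
  rcases key hg he hf (by rw [hsum]; abel) with h | h6
  · exact .inr h
  have htr := congr_arg (LinearMap.trace F V) hsum
  simp only [map_add, map_smul, LinearMap.trace_one, smul_eq_mul, h4, h5, h6, hV] at htr
  left
  have h7 : (3 / 2 : F) * (2 * m) = 3 * m := by field_simp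
  linear_combination htr - h7

end Scalar

/-! ### Invertible matrices that are not sums of three idempotents -/

section Matrix

variable {F : Type*} [Field F]

theorem exists_natCast_eq_trace {n : Type*} [Fintype n] [DecidableEq n] {A : Matrix n n F}
    (h : IsSumOfThreeIdempotents A) : ∃ k : ℕ, A.trace = k := by
  obtain ⟨e, f, g, he, hf, hg, rfl⟩ := h
  have key : ∀ {e : Matrix n n F}, IsIdempotentElem e → ∃ k : ℕ, e.trace = k := by
    intro e he
    have := LinearMap.trace_of_isIdempotentElem (he.map (Matrix.toLinAlgEquiv' (R := F) (n := n)))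
    exact ⟨_, (Matrix.trace_toLin'_eq e).symm.trans this⟩
  obtain ⟨i, hi⟩ := key he
  obtain ⟨j, hj⟩ := key hf
  obtain ⟨k, hk⟩ := key hg
  exact ⟨i + j + k, by simp [Matrix.trace_add, hi, hj, hk]⟩

theorem nonempty_ringEquiv_zmod {p : ℕ} [Fact p.Prime] [CharP F p]
    (h : ∀ a : F, ∃ k : ℤ, a = k) : Nonempty (F ≃+* ZMod p) := by
  refine ⟨(RingEquiv.ofBijective (ZMod.castHom dvd_rfl F) ⟨RingHom.injective _, fun a ↦ ?_⟩).symm⟩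
  obtain ⟨k, rfl⟩ := h a
  exact ⟨k, map_intCast _ k⟩

variable {m : ℕ}
  (h : ∀ A : Matrix (Fin (m + 1)) (Fin (m + 1)) F, IsUnit A → IsSumOfThreeIdempotents A)
include h

theorem exists_intCast_eq_of_isSumOfThreeIdempotents (a : F) : ∃ k : ℤ, a = k := by
  rcases eq_or_ne a 0 with rfl | ha
  · exact ⟨0, by simp⟩
  have hu : IsUnit (Matrix.diagonal (Function.update (1 : Fin (m + 1) → F) 0 a)) := by
    rw [Matrix.isUnit_iff_isUnit_det, Matrix.det_diagonal,
      Finset.prod_update_of_mem (Finset.mem_univ _)]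
    simpa using ha
  obtain ⟨k, hk⟩ := exists_natCast_eq_trace (h _ hu)
  rw [Matrix.trace_diagonal, Finset.sum_update_of_mem (Finset.mem_univ _)] at hk
  refine ⟨k - m, ?_⟩
  push_cast
  rw [← hk]
  simp [Finset.card_sdiff]

theorem two_eq_zero_or_three_eq_zero : (2 : F) = 0 ∨ (3 : F) = 0 := by
  by_contra! hne
  obtain ⟨h2, h3⟩ := hne
  have h32 : (3 / 2 : F) ≠ 0 := div_ne_zero h3 h2
  let φ := Matrix.toLinAlgEquiv' (R := F) (n := Fin (m + 1))
  have hscalar := (h ((3 / 2 : F) • 1) (by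
    rw [Matrix.isUnit_iff_isUnit_det]; simpa using h32)).map φ
  rw [map_smul, map_one] at hscalar
  have heven := even_finrank_of_scalar h2 h3 hscalar
  -- In even dimension, `-2` is none of `0`, `1`, `-1`, and `3/2 - 2 = -1/2` is nonzero.
  let R : Matrix (Fin (m + 1)) (Fin (m + 1)) F := Matrix.diagonal (Pi.single 0 (-2))
  have hdiag : (3 / 2 : F) • 1 + R =
      Matrix.diagonal (Function.update (fun _ : Fin (m + 1) ↦ (3 / 2 : F)) 0 (-(1 / 2))) := by
    have : (3 / 2 : F) - 2 = -(1 / 2) := by field_simp; norm_num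
    rw [Matrix.smul_one_eq_diagonal, Matrix.diagonal_add]
    congr 1
    ext i
    by_cases hi : i = 0
    · subst hi
      rw [Pi.single_eq_same, Function.update_self, ← this, sub_eq_add_neg]
    · simp [hi]
  have hsum := (h ((3 / 2 : F) • 1 + R) (by
    rw [hdiag, Matrix.isUnit_iff_isUnit_det, Matrix.det_diagonal,
      Finset.prod_update_of_mem (Finset.mem_univ _)]
    simp [h2, h3])).map φ
  rw [map_add, map_smul, map_one] at hsum
  have hrank : finrank F (LinearMap.range (φ R)) ≤ 1 := by
    classical
    change R.rank ≤ 1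
    rw [Matrix.rank_diagonal]
    refine Fintype.card_le_one_iff_subsingleton.2 ⟨fun ⟨i, hi⟩ ⟨j, hj⟩ ↦ Subtype.ext ?_⟩
    have hz : ∀ i, (Pi.single 0 (-2) : Fin (m + 1) → F) i ≠ 0 → i = 0 := fun i hi ↦ by
      by_contra h
      exact hi (Pi.single_eq_of_ne h _)
    exact (hz i hi).trans (hz j hj).symm
  have htr : LinearMap.trace F _ (φ R) = -2 := by
    refine (Matrix.trace_toLin'_eq R).trans ?_
    simp [R]
  rcases trace_of_scalar_add_rank_one h2 h3 hrank heven hsum with h | h | h <;> rw [htr] at h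
  · exact h2 (by linear_combination -h)
  · exact h3 (by linear_combination -h)
  · exact one_ne_zero (by linear_combination -h : (1 : F) = 0)

end Matrix

theorem forall_eq_zero_or_one_or_two {F : Type*} [Field F]
    (h : Nonempty (F ≃+* ZMod 2) ∨ Nonempty (F ≃+* ZMod 3)) (a : F) : a = 0 ∨ a = 1 ∨ a = 2 := by
  rcases h with ⟨⟨φ⟩⟩ | ⟨⟨φ⟩⟩
  · have : ∀ b : ZMod 2, b = 0 ∨ b = 1 ∨ b = 2 := by decide
    simpa [← map_ofNat φ] using this (φ a)
  · have : ∀ b : ZMod 3, b = 0 ∨ b = 1 ∨ b = 2 := by decide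
    simpa [← map_ofNat φ] using this (φ a)

theorem theorem2p6 {F : Type*} [Field F] (n : ℕ) (hn : 1 ≤ n) :
    List.TFAE [
      ∀ A : Matrix (Fin n) (Fin n) F, IsSumOfThreeIdempotents A,
      ∀ A : Matrix (Fin n) (Fin n) F, IsUnit A → IsSumOfThreeIdempotents A,
      Nonempty (F ≃+* ZMod 2) ∨ Nonempty (F ≃+* ZMod 3)] := by
  tfae_have 1 → 2 := fun h A _ ↦ h A
  tfae_have 2 → 3 := by
    obtain ⟨m, rfl⟩ := Nat.exists_eq_add_of_le' hn
    intro h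
    have hint := exists_intCast_eq_of_isSumOfThreeIdempotents h
    rcases two_eq_zero_or_three_eq_zero h with h2 | h3
    · have : CharP F 2 := CharTwo.of_one_ne_zero_of_two_eq_zero one_ne_zero h2
      exact .inl (nonempty_ringEquiv_zmod hint)
    · have : CharP F 3 := (CharP.charP_iff_prime_eq_zero Nat.prime_three).2 (by exact_mod_cast h3)
      exact .inr (nonempty_ringEquiv_zmod hint)
  tfae_have 3 → 1 := fun h A ↦ isSumOfThreeIdempotents_matrix (forall_eq_zero_or_one_or_two h) A
  tfae_finish
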